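/- Let $r,t\in[0,1]$ with $r^2+t^2=1$. Write $\mathbb T=\{z\in\mathbb C:|z|=1\}$ and $\mathbb Z_{2M}=\mathbb Z/2M\mathbb Z$ for an integer $M\ge 1$. For $q=(q_1,q_2,q_3)\in\mathbb T^3$ let $$S(q)=\begin{pmatrix}q_1q_2&0\\0&q_1\overline{q_2}\end{pmatrix}\begin{pmatrix}t&-r\\r&t\end{pmatrix}\begin{pmatrix}q_3&0\\0&\overline{q_3}\end{pmatrix}.$$ Let the phases $p=(p(2j,2k))$ consist of elements $p(2j,2k)=(p_e(2j,2k),p_o(2j+1,2k+1))\in\mathbb T^3\times\mathbb T^3$. The Chalker–Coddington operator $\widehat U(p)$ on $\ell^2(\mathbb Z^2)$, with canonical basis $(e_\mu)$, is the unitary operator whose matrix elements $\widehat U_{\mu;\nu}=\langle e_\mu,\widehat U e_\nu\rangle$ vanish except for the blocks $$\begin{pmatrix}\widehat U_{(2j+1,2k);(2j,2k)}&\widehat U_{(2j+1,2k);(2j+1,2k+1)}\\ \widehat U_{(2j,2k+1);(2j,2k)}&\widehat U_{(2j,2k+1);(2j+1,2k+1)}\end{pmatrix}=S(p_e(2j,2k)),$$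 $$\begin{pmatrix}\widehat U_{(2j+2,2k+2);(2j+2,2k+1)}&\widehat U_{(2j+2,2k+2);(2j+1,2k+2)}\\ \widehat U_{(2j+1,2k+1);(2j+2,2k+1)}&\widehat U_{(2j+1,2k+1);(2j+1,2k+2)}\end{pmatrix}=S(p_o(2j+1,2k+1))$$ for $j,k\in\mathbb Z$. The cylinder operator $U(p)$ on $\ell^2(\mathbb Z\times\mathbb Z_{2M})$ is the unitary operator defined by the same blocks, with all second coordinates understood modulo $2M$. A unitary operator $W$ on a Hilbert space $H$ has purely absolutely continuous spectrum if for every $\psi\in H$ the spectral measure of $W$ at $\psi$, i.e. the finite Borel measure $\mu_\psi$ on $\mathbb T$ with $\langle\psi,W^n\psi\rangle=\int_{\mathbb T}z^n\,d\mu_\psi(z)$ for all $n\in\mathbb Z$, is absolutely continuous with respect to Lebesgue measure on $\mathbb T$. **Proposition.** Suppose $rt\neq0$ and that all phases are equal to $1$. Then 1. the operator $\widehat U(\ldots,1,1,1,\ldots)$ on $\ell^2(\mathbb Z^2)$ has purely absolutely continuous spectrum; 2. for every integer $M\ge1$, the operator $U(\ldots,1,1,1,\ldots)$ on $\ell^2(\mathbb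 Z\times\mathbb Z_{2M})$ has purely absolutely continuous spectrum. -/

import Mathlib

open scoped InnerProductSpace

noncomputable section

/-! ### Absolutely continuous spectrum of a unitary operator -/

/-- `μ` is the spectral measure of the unitary operator `U` at the vector `ψ`: the finite Borel
measure on the unit circle (parametrised by `x ∈ ℝ/ℤ`, `x ↦ exp (2πix)`) such that
`⟪ψ, Uⁿ ψ⟫ = ∫ zⁿ dμ(z)` for all `n ∈ ℤ`. Here `fourier n x = exp (2πinx)`. -/
def IsSpectralMeasure {H : Type*} [NormedAddCommGroup H] [InnerProductSpace ℂ H]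
    (U : H ≃ₗᵢ[ℂ] H) (ψ : H) (μ : MeasureTheory.Measure UnitAddCircle) : Prop :=
  MeasureTheory.IsFiniteMeasure μ ∧
    ∀ n : ℤ, ⟪ψ, (U ^ n) ψ⟫_ℂ = ∫ x, fourier n x ∂μ

/-- The absolutely continuous subspace of `U`: the vectors whose spectral measure is absolutely
continuous with respect to Lebesgue measure on the circle. -/
def acSubspace {H : Type*} [NormedAddCommGroup H] [InnerProductSpace ℂ H]
    (U : H ≃ₗᵢ[ℂ] H) : Set H :=
  {ψ | ∃ μ : MeasureTheory.Measure UnitAddCircle,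
    IsSpectralMeasure U ψ μ ∧ μ.AbsolutelyContinuous MeasureTheory.volume}

/-- `U` has purely absolutely continuous spectrum: the absolutely continuous subspace is the whole
Hilbert space. -/
def HasPurelyACSpectrum {H : Type*} [NormedAddCommGroup H] [InnerProductSpace ℂ H]
    (U : H ≃ₗᵢ[ℂ] H) : Prop :=
  acSubspace U = Set.univ

/-! ### The Chalker–Coddington network operator -/

namespace ChalkerCoddington

/-- The scattering matrix `S(q)` of the three phases `q = (q₁, q₂, q₃)`. -/
def S (r t : ℝ) (q : Fin 3 → Circle) : Matrix (Fin 2) (Fin 2) ℂ :=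
  !![(q 0 * q 1 : ℂ), 0; 0, q 0 * star (q 1 : ℂ)] *
    !![(t : ℂ), -r; r, t] *
    !![(q 2 : ℂ), 0; 0, star (q 2 : ℂ)]

/-- The groups used for the second coordinate of the lattice, `ℤ` and `ℤ/2Mℤ`: parity makes sense
in them, i.e. adding one exchanges even and odd elements. -/
class HasParity (A : Type*) [CommRing A] : Prop where
  even_add_one : ∀ a : A, Even (a + 1) ↔ ¬ Even a

instance : HasParity ℤ := ⟨fun _ => Int.even_add_one⟩

instance (M : ℕ) : HasParity (ZMod (2 * M)) := by
  have key : ∀ n : ℤ, Even (n : ZMod (2 * M)) ↔ Even n := by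
    intro n
    constructor
    · rintro ⟨s, hs⟩
      obtain ⟨k, rfl⟩ := ZMod.intCast_surjective s
      rw [← Int.cast_add, ZMod.intCast_eq_intCast_iff_dvd_sub] at hs
      obtain ⟨c, hc⟩ := hs
      push_cast at hc
      exact ⟨k - M * c, by linear_combination -hc⟩
    · rintro ⟨s, rfl⟩
      exact ⟨s, by push_cast; rfl⟩
  refine ⟨fun a => ?_⟩
  obtain ⟨n, rfl⟩ := ZMod.intCast_surjective a
  have h := key (n + 1)
  push_cast at h
  rw [h, key, Int.even_add_one]

section Lattice

variable {A : Type*} [CommRing A] [DecidableEq A]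

/-- The Hilbert space `ℓ²(ℤ × A)`. -/
abbrev L2 (A : Type*) : Type _ := lp (fun _ : ℤ × A => ℂ) 2

/-- The canonical basis vector `e_μ` of `ℓ²(ℤ × A)`. -/
def e {A : Type*} [DecidableEq A] (μ : ℤ × A) : L2 A := lp.single 2 μ (1 : ℂ)

/-- The phases `p_e(2j, 2k)` of the even node at `x = (2j, 2k)`: the first three components of
`p (2j, 2k)`. A phase configuration is a function `p`, of which only the values at the sites with
two even coordinates play a role. -/
def pe (p : ℤ × A → Fin 6 → Circle) (x : ℤ × A) : Fin 3 → Circle := ![p x 0, p x 1, p x 2]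

/-- The phases `p_o(2j + 1, 2k + 1)` of the odd node belonging to `x = (2j, 2k)`: the last three
components of `p (2j, 2k)`. -/
def po (p : ℤ × A → Fin 6 → Circle) (x : ℤ × A) : Fin 3 → Circle := ![p x 3, p x 4, p x 5]

open Classical in
/-- The column `U e_ν` of the network operator with phases `p`, at `ν = (m, n)`. The four cases are
* `ν = (2j, 2k)`: entries `S(p_e(2j,2k))₁₁` at `(2j+1, 2k)` and `S(p_e(2j,2k))₂₁` at `(2j, 2k+1)`;
* `ν = (2j+2, 2k+1)`: entries `S(p_o(2j+1,2k+1))₁₁` at `(2j+2, 2k+2)` and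
  `S(p_o(2j+1,2k+1))₂₁` at `(2j+1, 2k+1)`;
* `ν = (2j+1, 2k+2)`: entries `S(p_o(2j+1,2k+1))₁₂` at `(2j+2, 2k+2)` and
  `S(p_o(2j+1,2k+1))₂₂` at `(2j+1, 2k+1)`;
* `ν = (2j+1, 2k+1)`: entries `S(p_e(2j,2k))₁₂` at `(2j+1, 2k)` and `S(p_e(2j,2k))₂₂` at
  `(2j, 2k+1)`. -/
def column (r t : ℝ) (p : ℤ × A → Fin 6 → Circle) : ℤ × A → L2 A := fun (m, n) =>
  if Even m then
    if Even n then
      S r t (pe p (m, n)) 0 0 • e (m + 1, n) + S r t (pe p (m, n)) 1 0 • e (m, n + 1)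
    else
      S r t (po p (m - 2, n - 1)) 0 0 • e (m, n + 1) +
        S r t (po p (m - 2, n - 1)) 1 0 • e (m - 1, n)
  else
    if Even n then
      S r t (po p (m - 1, n - 2)) 0 1 • e (m + 1, n) +
        S r t (po p (m - 1, n - 2)) 1 1 • e (m, n - 1)
    else
      S r t (pe p (m - 1, n - 1)) 0 1 • e (m, n - 1) +
        S r t (pe p (m - 1, n - 1)) 1 1 • e (m - 1, n)

theorem S_unitary {r t : ℝ} (h : r ^ 2 + t ^ 2 = 1) (q : Fin 3 → Circle) :
    S r t q ∈ Matrix.unitaryGroup (Fin 2) ℂ := by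
  have hC : (r : ℂ) ^ 2 + (t : ℂ) ^ 2 = 1 := by exact_mod_cast h
  have hq : ∀ i, (q i : ℂ) * (starRingEnd ℂ) (q i : ℂ) = 1 := fun i => by
    rw [Complex.mul_conj, Circle.normSq_coe]; simp
  have h1 : !![(q 0 * q 1 : ℂ), 0; 0, q 0 * star (q 1 : ℂ)] ∈ Matrix.unitaryGroup (Fin 2) ℂ := by
    rw [Matrix.mem_unitaryGroup_iff]
    ext i j
    fin_cases i <;> fin_cases j <;>
      simp [Matrix.mul_apply, Matrix.star_apply, Fin.sum_univ_two]
    · linear_combination (q 1 : ℂ) * (starRingEnd ℂ) (q 1 : ℂ) * hq 0 + hq 1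
    · linear_combination (q 1 : ℂ) * (starRingEnd ℂ) (q 1 : ℂ) * hq 0 + hq 1
  have h2 : !![(t : ℂ), -r; r, t] ∈ Matrix.unitaryGroup (Fin 2) ℂ := by
    rw [Matrix.mem_unitaryGroup_iff]
    ext i j
    fin_cases i <;> fin_cases j <;>
      simp [Matrix.mul_apply, Matrix.star_apply, Fin.sum_univ_two]
    all_goals first | linear_combination hC | ring
  have h3 : !![(q 2 : ℂ), 0; 0, star (q 2 : ℂ)] ∈ Matrix.unitaryGroup (Fin 2) ℂ := by
    rw [Matrix.mem_unitaryGroup_iff]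
    ext i j
    fin_cases i <;> fin_cases j <;>
      simp [Matrix.mul_apply, Matrix.star_apply, Fin.sum_univ_two]
    · linear_combination hq 2
    · linear_combination hq 2
  exact mul_mem (mul_mem h1 h2) h3

theorem inner_e_left {A : Type*} [DecidableEq A] (μ : ℤ × A) (ψ : L2 A) : ⟪e μ, ψ⟫_ℂ = ψ μ := by
  rw [e, lp.inner_single_left]; simp

theorem e_apply {A : Type*} [DecidableEq A] (μ ν : ℤ × A) : (e μ : L2 A) ν = if ν = μ then 1 else 0 := by
  rw [e, lp.coeFn_single, Pi.single_apply]

theorem inner_pair {A : Type*} [DecidableEq A] (a b c d : ℂ) (x y z w : ℤ × A) :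
    ⟪a • e x + b • e y, c • e z + d • e w⟫_ℂ =
      star a * ((if x = z then c else 0) + (if x = w then d else 0)) +
      star b * ((if y = z then c else 0) + (if y = w then d else 0)) := by
  rw [inner_add_left, inner_smul_left, inner_smul_left, inner_e_left, inner_e_left]
  simp only [lp.coeFn_add, lp.coeFn_smul, Pi.add_apply, Pi.smul_apply, e_apply, smul_eq_mul,
    mul_ite, mul_one, mul_zero, starRingEnd_apply]

theorem column_ee {r t : ℝ} {p : ℤ × A → Fin 6 → Circle} {m : ℤ} {n : A}
    (hm : Even m) (hn : Even n) : column r t p (m, n) =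
      S r t (pe p (m, n)) 0 0 • e (m + 1, n) + S r t (pe p (m, n)) 1 0 • e (m, n + 1) := by
  simp [column, hm, hn]

theorem column_eo {r t : ℝ} {p : ℤ × A → Fin 6 → Circle} {m : ℤ} {n : A}
    (hm : Even m) (hn : ¬ Even n) : column r t p (m, n) =
      S r t (po p (m - 2, n - 1)) 0 0 • e (m, n + 1) +
        S r t (po p (m - 2, n - 1)) 1 0 • e (m - 1, n) := by
  simp [column, hm, hn]

theorem column_oe {r t : ℝ} {p : ℤ × A → Fin 6 → Circle} {m : ℤ} {n : A}
    (hm : ¬ Even m) (hn : Even n) : column r t p (m, n) =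
      S r t (po p (m - 1, n - 2)) 0 1 • e (m + 1, n) +
        S r t (po p (m - 1, n - 2)) 1 1 • e (m, n - 1) := by
  rw [column]; simp only [hm, hn, if_true, if_false]

theorem column_oo {r t : ℝ} {p : ℤ × A → Fin 6 → Circle} {m : ℤ} {n : A}
    (hm : ¬ Even m) (hn : ¬ Even n) : column r t p (m, n) =
      S r t (pe p (m - 1, n - 1)) 0 1 • e (m, n - 1) +
        S r t (pe p (m - 1, n - 1)) 1 1 • e (m - 1, n) := by
  rw [column]; simp only [hm, hn, if_false]

theorem S_cols {r t : ℝ} (h : r ^ 2 + t ^ 2 = 1) (q : Fin 3 → Circle) (i j : Fin 2) :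
    star (S r t q 0 i) * S r t q 0 j + star (S r t q 1 i) * S r t q 1 j =
      if i = j then 1 else 0 := by
  have := congrFun (congrFun (Matrix.mem_unitaryGroup_iff'.1 (S_unitary h q)) i) j
  simpa [Matrix.mul_apply, Matrix.one_apply] using this

theorem S_rows {r t : ℝ} (h : r ^ 2 + t ^ 2 = 1) (q : Fin 3 → Circle) (i j : Fin 2) :
    S r t q i 0 * star (S r t q j 0) + S r t q i 1 * star (S r t q j 1) =
      if i = j then 1 else 0 := by
  have := congrFun (congrFun (Matrix.mem_unitaryGroup_iff.1 (S_unitary h q)) i) j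
  simpa [Matrix.mul_apply, Matrix.one_apply] using this

theorem HasParity.even_sub_one {A : Type*} [CommRing A] [HasParity A] (a : A) : Even (a - 1) ↔ ¬ Even a := by
  have := HasParity.even_add_one (a - 1)
  rw [sub_add_cancel] at this
  tauto

set_option maxHeartbeats 1000000 in
theorem column_orthonormal [HasParity A] {r t : ℝ} (h : r ^ 2 + t ^ 2 = 1)
    (p : ℤ × A → Fin 6 → Circle) : Orthonormal ℂ (column r t p) := by
  have P := @HasParity.even_add_one A _ _
  have P' := @HasParity.even_sub_one A _ _
  have Q := @HasParity.even_add_one ℤ _ _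
  have Q' := @HasParity.even_sub_one ℤ _ _
  have hS := fun q => S_cols h q
  rw [orthonormal_iff_ite]
  rintro ⟨m, n⟩ ⟨m', n'⟩
  by_cases hm : Even m <;> by_cases hn : Even n <;> by_cases hm' : Even m' <;>
    by_cases hn' : Even n'
  all_goals simp only [hm, hn, hm', hn', column_ee, column_eo, column_oe, column_oo,
    not_false_eq_true, inner_pair, Prod.mk.injEq]
  · grind
  · clear hS
    rw [if_neg (by grind only), if_neg (by grind only), if_neg (by grind only),
      if_neg (by grind only), if_neg (by grind only)]
    simp
  · clear hS
    rw [if_neg (by grind only), if_neg (by grind only), if_neg (by grind only),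
      if_neg (by grind only), if_neg (by grind only)]
    simp
  · have key := hS (pe p (m, n)) 0 1
    by_cases c : m' = m + 1 ∧ n' = n + 1
    · obtain ⟨rfl, rfl⟩ := c
      have e1 : ¬ (n = n + 1) := by grind
      simpa [e1] using key
    · grind
  · clear hS
    rw [if_neg (by grind only), if_neg (by grind only), if_neg (by grind only),
      if_neg (by grind only), if_neg (by grind only)]
    simp
  · grind
  · have key := hS (po p (m - 2, n - 1)) 0 1
    by_cases c : m = m' + 1 ∧ n' = n + 1
    · obtain ⟨rfl, rfl⟩ := c
      have e1 : ¬ (n = n + 1) := by grind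
      have e2 : m' + 1 - 2 = m' - 1 := by ring
      have e3 : n + 1 - 2 = n - 1 := by ring
      rw [e2] at key
      simpa [e1, e2, e3] using key
    · grind
  · clear hS
    rw [if_neg (by grind only), if_neg (by grind only), if_neg (by grind only),
      if_neg (by grind only), if_neg (by grind only)]
    simp
  · clear hS
    rw [if_neg (by grind only), if_neg (by grind only), if_neg (by grind only),
      if_neg (by grind only), if_neg (by grind only)]
    simp
  · have key := hS (po p (m - 1, n - 2)) 1 0
    by_cases c : m' = m + 1 ∧ n = n' + 1
    · obtain ⟨rfl, rfl⟩ := c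
      have e1 : ¬ (n' + 1 = n') := by grind
      have e2 : m + 1 - 2 = m - 1 := by ring
      have e3 : n' + 1 - 2 = n' - 1 := by ring
      rw [e3] at key
      simpa [e1, e2, e3] using key
    · grind
  · grind
  · clear hS
    rw [if_neg (by grind only), if_neg (by grind only), if_neg (by grind only),
      if_neg (by grind only), if_neg (by grind only)]
    simp
  · have key := hS (pe p (m - 1, n - 1)) 1 0
    by_cases c : m = m' + 1 ∧ n = n' + 1
    · obtain ⟨rfl, rfl⟩ := c
      have e1 : ¬ (n' + 1 = n') := by grind
      simpa [e1] using key
    · grind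
  · clear hS
    rw [if_neg (by grind only), if_neg (by grind only), if_neg (by grind only),
      if_neg (by grind only), if_neg (by grind only)]
    simp
  · clear hS
    rw [if_neg (by grind only), if_neg (by grind only), if_neg (by grind only),
      if_neg (by grind only), if_neg (by grind only)]
    simp
  · grind

theorem S_cols_injective {r t : ℝ} (h : r ^ 2 + t ^ 2 = 1) (q : Fin 3 → Circle) {u v : ℂ}
    (h0 : star (S r t q 0 0) * u + star (S r t q 1 0) * v = 0)
    (h1 : star (S r t q 0 1) * u + star (S r t q 1 1) * v = 0) : u = 0 ∧ v = 0 := by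
  have a := S_rows h q 0 0
  have b := S_rows h q 0 1
  have c := S_rows h q 1 0
  have d := S_rows h q 1 1
  simp only [if_true, Fin.zero_eq_one_iff, Fin.one_eq_zero_iff, OfNat.ofNat_ne_one, if_false] at a b c d
  constructor
  · linear_combination S r t q 0 0 * h0 + S r t q 0 1 * h1 - u * a - v * b
  · linear_combination S r t q 1 0 * h0 + S r t q 1 1 * h1 - u * c - v * d

theorem column_span [HasParity A] {r t : ℝ} (h : r ^ 2 + t ^ 2 = 1)
    (p : ℤ × A → Fin 6 → Circle) : (Submodule.span ℂ (Set.range (column r t p)))ᗮ = ⊥ := by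
  have P := @HasParity.even_add_one A _ _
  have P' := @HasParity.even_sub_one A _ _
  have Q := @HasParity.even_add_one ℤ _ _
  have Q' := @HasParity.even_sub_one ℤ _ _
  rw [eq_bot_iff]
  intro ψ hψ
  have H : ∀ ν, ⟪column r t p ν, ψ⟫_ℂ = 0 := fun ν =>
    (Submodule.mem_orthogonal _ _).1 hψ _ (Submodule.subset_span ⟨ν, rfl⟩)
  have I : ∀ (a b : ℂ) (x y : ℤ × A),
      ⟪a • e x + b • e y, ψ⟫_ℂ = star a * ψ x + star b * ψ y := by
    intro a b x y
    rw [inner_add_left, inner_smul_left, inner_smul_left, inner_e_left, inner_e_left]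
    rfl
  have E : ∀ (m : ℤ) (n : A), Even m → Even n → ψ (m + 1, n) = 0 ∧ ψ (m, n + 1) = 0 := by
    intro m n hm hn
    have h0 := H (m, n)
    have h1 := H (m + 1, n + 1)
    rw [column_ee hm hn, I] at h0
    rw [column_oo (by simpa [Q] using hm) (by simpa [P] using hn), I] at h1
    simp only [add_sub_cancel_right] at h1
    exact S_cols_injective h _ h0 h1
  have O : ∀ (m : ℤ) (n : A), Even m → Even n →
      ψ (m + 2, n + 2) = 0 ∧ ψ (m + 1, n + 1) = 0 := by
    intro m n hm hn
    have hm1 : ¬ Even (m + 1) := by simpa [Q] using hm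
    have hn1 : ¬ Even (n + 1) := by simpa [P] using hn
    have em : m + 1 + 1 = m + 2 := by ring
    have en : n + 1 + 1 = n + 2 := by ring
    have hm2 : Even (m + 2) := by rw [← em, Q]; exact hm1
    have hn2 : Even (n + 2) := by rw [← en, P]; exact hn1
    have h0 := H (m + 2, n + 1)
    have h1 := H (m + 1, n + 2)
    rw [column_eo hm2 hn1, I] at h0
    rw [column_oe hm1 hn2, I] at h1
    have e1 : m + 2 - 1 = m + 1 := by ring
    have e2 : n + 2 - 1 = n + 1 := by ring
    simp only [add_sub_cancel_right, em, en, e1, e2] at h0 h1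
    exact S_cols_injective h _ h0 h1
  have Z : ∀ μ : ℤ × A, ψ μ = 0 := by
    rintro ⟨m, n⟩
    by_cases hm : Even m <;> by_cases hn : Even n
    · have hm2 : Even (m - 2) := by
        rw [show m - 2 = m - 1 - 1 by ring, Q', Q']; exact not_not.2 hm
      have hn2 : Even (n - 2) := by
        rw [show n - 2 = n - 1 - 1 by ring, P', P']; exact not_not.2 hn
      simpa using (O (m - 2) (n - 2) hm2 hn2).1
    · simpa using (E m (n - 1) hm (by rwa [P'])).2
    · simpa using (E (m - 1) n (by rwa [Q']) hn).1
    · simpa using (O (m - 1) (n - 1) (by rwa [Q']) (by rwa [P'])).2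
  rw [Submodule.mem_bot]
  exact lp.ext (funext Z)

/-- The network operator with phases `p`, as a unitary operator on `ℓ²(ℤ × A)`; it is determined by
`network e_ν = column ν`. -/
def network [HasParity A] (r t : ℝ) (h : r ^ 2 + t ^ 2 = 1) (p : ℤ × A → Fin 6 → Circle) :
    L2 A ≃ₗᵢ[ℂ] L2 A :=
  (HilbertBasis.mkOfOrthogonalEqBot (column_orthonormal h p) (column_span h p)).repr.symm

theorem network_e [HasParity A] {r t : ℝ} (h : r ^ 2 + t ^ 2 = 1) (p : ℤ × A → Fin 6 → Circle)
    (ν : ℤ × A) : network r t h p (e ν) = column r t p ν := by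
  rw [network, e, HilbertBasis.repr_symm_single, HilbertBasis.coe_mkOfOrthogonalEqBot]

end Lattice

/-- The operator `Û(p)` on the full lattice `ℤ²`. -/
def fullOperator (r t : ℝ) (h : r ^ 2 + t ^ 2 = 1) (p : ℤ × ℤ → Fin 6 → Circle) :
    L2 ℤ ≃ₗᵢ[ℂ] L2 ℤ :=
  network r t h p

/-- The operator `U(p)` on the cylinder `ℤ × ℤ/2Mℤ`. -/
def cylinderOperator (M : ℕ) (r t : ℝ) (h : r ^ 2 + t ^ 2 = 1)
    (p : ℤ × ZMod (2 * M) → Fin 6 → Circle) : L2 (ZMod (2 * M)) ≃ₗᵢ[ℂ] L2 (ZMod (2 * M)) :=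
  network r t h p

end ChalkerCoddington
end

/-!
Let `U` be the network operator with all phases equal to `1`, and let `T` and `V` be the
translations by `(2, 0)` and `(0, 2)`. They commute, and
`U² - U⁻² = rt ((V - V⁻¹) - (T - T⁻¹))`. On the joint spectrum, a subset of the torus with
coordinates `x`, `y`, `z` for `U`, `T`, `V`, this says
`(rt)⁻¹ sin (4πx) = sin (2πz) - sin (2πy)`.

Since `⟪e_μ, Tⁱ Vʲ e_μ⟫ = 0` for `i ≠ 0`, the distribution of `(y, z)` under the joint spectral
measure of a basis vector is invariant under rotations of `y`. For fixed `z`, the sine takes values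
in a Lebesgue null set only for a null set of `y`; hence `sin (2πz) - sin (2πy)` has an absolutely
continuous distribution. As the sine maps null sets to null sets, `x` has an absolutely continuous
distribution as well. Finally, the vectors whose spectral measure vanishes on a given null set form
a closed subspace, so the basis vectors suffice.

Rotating `y` alone replaces a Fourier transform of `ℤ × ℤ/2Mℤ`, and the same argument covers the
plane and the cylinders.
-/

noncomputable section

open MeasureTheory Set Filter
open scoped ComplexOrder

/-! ### Null sets and the sine on the circle -/

theorem addHaar_inter_preimage_eq_zero {E : Type*} [NormedAddCommGroup E] [NormedSpace ℝ E]
    [FiniteDimensional ℝ E] [MeasurableSpace E] [BorelSpace E] (μ : Measure E) [μ.IsAddHaarMeasure]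
    {f : E → E} {s M : Set E}
    (hf : ∀ x ∈ s, ∃ f' : E ≃L[ℝ] E, HasStrictFDerivAt f (f' : E →L[ℝ] E) x) (hM : μ M = 0) :
    μ (s ∩ f ⁻¹' M) = 0 := by
  refine measure_null_of_locally_null _ fun x hx => ?_
  obtain ⟨f'x, hx'⟩ := hf x hx.1
  -- Near `x`, the set is the image of a null set under the differentiable local inverse of `f`.
  let F := hx'.toOpenPartialHomeomorph f
  let D := F.target ∩ (F.symm ⁻¹' s ∩ M)
  have hF : DifferentiableOn ℝ F.symm D := fun y hy =>
    have ⟨_, hy'⟩ := hf _ hy.2.1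
    (F.hasFDerivAt_symm hy.1 hy'.hasFDerivAt).differentiableAt.differentiableWithinAt
  refine ⟨F.symm '' D, ?_, addHaar_image_eq_zero_of_differentiableOn_of_addHaar_eq_zero μ hF
    (measure_mono_null (inter_subset_right.trans inter_subset_right) hM)⟩
  filter_upwards [nhdsWithin_le_nhds (F.open_source.mem_nhds
    hx'.mem_toOpenPartialHomeomorph_source), self_mem_nhdsWithin] with y hyF hy
  refine ⟨F y, ⟨F.map_source hyF, ?_, hy.2⟩, F.left_inv hyF⟩
  rw [mem_preimage, F.left_inv hyF]
  exact hy.1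

theorem volume_preimage_sin_eq_zero {M : Set ℝ} (hM : volume M = 0) :
    volume (Real.sin ⁻¹' M) = 0 := by
  have hcos : volume {x : ℝ | Real.cos x = 0} = 0 := by
    refine (countable_range fun k : ℤ => (2 * k + 1) * Real.pi / 2).mono (fun x hx => ?_)
      |>.measure_zero _
    obtain ⟨k, hk⟩ := Real.cos_eq_zero_iff.1 hx
    exact ⟨k, hk.symm⟩
  have hsin : volume ({x | Real.cos x ≠ 0} ∩ Real.sin ⁻¹' M) = 0 :=
    addHaar_inter_preimage_eq_zero volume
      (fun x hx => ⟨_, (Real.hasStrictDerivAt_sin x).hasStrictFDerivAt_equiv hx⟩) hM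
  refine measure_mono_null (fun x hx => ?_) (measure_union_null hcos hsin)
  exact (em (Real.cos x = 0)).imp id fun h => ⟨h, hx⟩

/-- The function `x ↦ sin (2πnx)` on `ℝ/ℤ`. -/
def circleSin (n : ℤ) : C(UnitAddCircle, ℝ) := ⟨fun x => (fourier n x).im, by fun_prop⟩

theorem circleSin_coe (n : ℤ) (x : ℝ) :
    circleSin n (x : UnitAddCircle) = Real.sin (2 * Real.pi * n * x) := by
  have h : (fourier n (x : UnitAddCircle) : ℂ) =
      Complex.exp ((2 * Real.pi * n * x : ℝ) * Complex.I) := by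
    rw [fourier_coe_apply]
    push_cast
    ring_nf
  exact (congrArg Complex.im h).trans (Complex.exp_ofReal_mul_I_im _)

theorem fourier_sub_fourier_neg (n : ℤ) (x : UnitAddCircle) :
    fourier n x - fourier (-n) x = 2 * circleSin n x * Complex.I := by
  rw [fourier_neg, Complex.sub_conj]
  simp [circleSin]

theorem volume_unitAddCircle_eq_zero_iff {N : Set UnitAddCircle} (hN : MeasurableSet N) :
    volume N = 0 ↔ volume (((↑) : ℝ → UnitAddCircle) ⁻¹' N ∩ Ioc 0 (0 + 1)) = 0 := by
  rw [← (UnitAddCircle.measurePreserving_mk 0).measure_preimage hN.nullMeasurableSet,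
    Measure.restrict_apply (AddCircle.measurable_mk' hN)]

theorem volume_image_circleSin_eq_zero (n : ℤ) {N : Set UnitAddCircle} (hN : volume N = 0) :
    volume (circleSin n '' N) = 0 := by
  wlog hmeas : MeasurableSet N generalizing N
  · exact measure_mono_null (image_mono (subset_toMeasurable _ _))
      (this ((measure_toMeasurable N).trans hN) (measurableSet_toMeasurable _ _))
  rw [volume_unitAddCircle_eq_zero_iff hmeas] at hN
  refine measure_mono_null ?_ (addHaar_image_eq_zero_of_differentiableOn_of_addHaar_eq_zero volume
    (f := fun x => Real.sin (2 * Real.pi * n * x)) (by fun_prop) hN)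
  rintro _ ⟨x, hx, rfl⟩
  obtain ⟨y, hy, rfl⟩ := (AddCircle.coe_image_Ioc_eq (1 : ℝ) 0).symm ▸ mem_univ x
  exact ⟨y, ⟨hx, hy⟩, (circleSin_coe n y).symm⟩

theorem volume_preimage_circleSin_eq_zero {n : ℤ} (hn : n ≠ 0) {M : Set ℝ} (hM : volume M = 0) :
    volume (circleSin n ⁻¹' M) = 0 := by
  wlog hmeas : MeasurableSet M generalizing M
  · exact measure_mono_null (preimage_mono (subset_toMeasurable _ _))
      (this ((measure_toMeasurable M).trans hM) (measurableSet_toMeasurable _ _))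
  rw [volume_unitAddCircle_eq_zero_iff ((circleSin n).continuous.measurable hmeas)]
  have hn' : 2 * Real.pi * n ≠ 0 := by positivity
  refine measure_mono_null inter_subset_left ?_
  have h := Real.volume_preimage_mul_left hn' (Real.sin ⁻¹' M)
  rw [volume_preimage_sin_eq_zero hM, mul_zero] at h
  refine Eq.trans (congrArg _ (ext fun x => ?_)) h
  simp only [mem_preimage, circleSin_coe]

theorem volume_preimage_sub_circleSin_eq_zero {n : ℤ} (hn : n ≠ 0) {M : Set ℝ} (hM : volume M = 0)
    (a : ℝ) (x : UnitAddCircle) : volume {θ | a - circleSin n (x + θ) ∈ M} = 0 := by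
  have ha : volume ((a - ·) ⁻¹' M) = 0 :=
    (Measure.measurePreserving_sub_left volume a).quasiMeasurePreserving.preimage_null hM
  have hpre : {θ | a - circleSin n (x + θ) ∈ M} =
      (x + ·) ⁻¹' (circleSin n ⁻¹' ((a - ·) ⁻¹' M)) := rfl
  rw [hpre, measure_preimage_add]
  exact volume_preimage_circleSin_eq_zero hn ha

theorem measure_eq_zero_of_forall_map_eq {Θ X : Type*} [MeasurableSpace Θ] [MeasurableSpace X]
    {μ : Measure X} [SFinite μ] {ν : Measure Θ} [SFinite ν] [NeZero ν] {a : X × Θ → X}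
    (ha : Measurable a) (hμ : ∀ θ, μ.map (fun x => a (x, θ)) = μ) {B : Set X}
    (hB : MeasurableSet B) (h : ∀ x, ν {θ | a (x, θ) ∈ B} = 0) : μ B = 0 := by
  have hfiber (θ : Θ) : μ ((fun x => (x, θ)) ⁻¹' (a ⁻¹' B)) = μ B := by
    conv_rhs => rw [← hμ θ, Measure.map_apply (by fun_prop) hB]
    rfl
  -- By Fubini, the average over `θ` of `μ {x | a (x, θ) ∈ B} = μ B` vanishes.
  have hzero : μ.prod ν (a ⁻¹' B) = 0 := by
    rw [Measure.prod_apply (ha hB)]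
    exact (lintegral_congr h).trans lintegral_zero
  rw [Measure.prod_apply_symm (ha hB), lintegral_congr hfiber, lintegral_const,
    mul_eq_zero] at hzero
  exact hzero.resolve_right (NeZero.ne ν ∘ Measure.measure_univ_eq_zero.1)

/-! ### Measures on the torus -/

theorem integrable_continuousMap {X E : Type*} [TopologicalSpace X] [CompactSpace X]
    [MeasurableSpace X] [OpensMeasurableSpace X] [NormedAddCommGroup E] (μ : Measure X)
    [IsFiniteMeasure μ] (f : C(X, E)) : Integrable f μ :=
  f.continuous.integrable_of_hasCompactSupport (HasCompactSupport.of_compactSpace f)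

theorem measure_ext_of_integral_continuousMap {X : Type*} [TopologicalSpace X]
    [HasOuterApproxClosed X] [MeasurableSpace X] [BorelSpace X] {μ ν : Measure X}
    [IsFiniteMeasure μ] [IsFiniteMeasure ν]
    (h : ∀ f : C(X, ℂ), ∫ x, f x ∂μ = ∫ x, f x ∂ν) : μ = ν := by
  refine ext_of_forall_integral_eq_of_IsFiniteMeasure fun f => ?_
  have := h ⟨fun x => (f x : ℂ), by fun_prop⟩
  simp only [ContinuousMap.coe_mk, integral_complex_ofReal] at this
  exact_mod_cast this

theorem continuous_integral_continuousMap {X : Type*} [TopologicalSpace X] [CompactSpace X]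
    [MeasurableSpace X] [BorelSpace X] (μ : Measure X) [IsFiniteMeasure μ] :
    Continuous fun f : C(X, ℂ) => ∫ x, f x ∂μ := by
  refine (continuous_integral.comp (ContinuousMap.toLp 1 μ ℂ).continuous).congr fun f => ?_
  exact integral_congr_ae (ContinuousMap.coeFn_toLp μ f)

section Torus

variable {d : Type*} [Fintype d] {μ ν : Measure (UnitAddTorus d)} [IsFiniteMeasure μ]

open UnitAddTorus

theorem measure_ext_of_integral_mFourier [IsFiniteMeasure ν]
    (h : ∀ n : d → ℤ, ∫ x, mFourier n x ∂μ = ∫ x, mFourier n x ∂ν) : μ = ν := by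
  refine measure_ext_of_integral_continuousMap fun f => ?_
  let L (μ : Measure (UnitAddTorus d)) [IsFiniteMeasure μ] : C(UnitAddTorus d, ℂ) →ₗ[ℂ] ℂ :=
    { toFun f := ∫ x, f x ∂μ
      map_add' f g := integral_add (integrable_continuousMap μ f) (integrable_continuousMap μ g)
      map_smul' c f := integral_const_mul c f }
  have hle : Submodule.span ℂ (range (mFourier (d := d))) ≤ LinearMap.eqLocus (L μ) (L ν) :=
    Submodule.span_le.2 (range_subset_iff.2 fun n => h n)
  exact Submodule.topologicalClosure_minimal _ hle (isClosed_eq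
    (continuous_integral_continuousMap μ) (continuous_integral_continuousMap ν))
    ((span_mFourier_closure_eq_top (d := d)).symm ▸ Submodule.mem_top)

theorem mFourier_single_of_eq_zero [DecidableEq d] {i : d} {n : d → ℤ} (hn : n i = 0)
    (θ : UnitAddCircle) : mFourier n (Pi.single i θ) = 1 := by
  refine Finset.prod_eq_one fun j _ => ?_
  obtain rfl | hj := eq_or_ne j i
  · rw [hn, fourier_zero]
  · rw [Pi.single_eq_of_ne hj, fourier_eval_zero]

theorem mFourier_apply_add (n : d → ℤ) (x y : UnitAddTorus d) :
    mFourier n (x + y) = mFourier n x * mFourier n y := by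
  simp [mFourier, AddCircle.toCircle_add, Finset.prod_mul_distrib]

theorem map_add_single_eq_self [DecidableEq d] {i : d}
    (h : ∀ n : d → ℤ, n i ≠ 0 → ∫ x, mFourier n x ∂μ = 0) (θ : UnitAddCircle) :
    μ.map (fun x => x + Pi.single i θ) = μ := by
  refine measure_ext_of_integral_mFourier fun n => ?_
  rw [integral_map (by fun_prop) (by fun_prop)]
  simp only [mFourier_apply_add, integral_mul_const]
  by_cases hn : n i = 0
  · rw [mFourier_single_of_eq_zero hn, mul_one]
  · rw [h n hn, zero_mul]

theorem measure_eq_zero_of_integral_mFourier_eq_zero [DecidableEq d] {i : d}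
    (h : ∀ n : d → ℤ, n i ≠ 0 → ∫ x, mFourier n x ∂μ = 0) {B : Set (UnitAddTorus d)}
    (hB : MeasurableSet B)
    (hfiber : ∀ x : UnitAddTorus d, volume {θ : UnitAddCircle | x + Pi.single i θ ∈ B} = 0) :
    μ B = 0 := by
  let a (p : UnitAddTorus d × UnitAddCircle) : UnitAddTorus d := p.1 + Pi.single i p.2
  have ha : Measurable a :=
    (continuous_fst.add ((continuous_single i).comp continuous_snd)).measurable
  have hinv (θ : UnitAddCircle) : μ.map (fun x => a (x, θ)) = μ := map_add_single_eq_self h θ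
  have hB' (x : UnitAddTorus d) : volume {θ : UnitAddCircle | a (x, θ) ∈ B} = 0 := hfiber x
  exact measure_eq_zero_of_forall_map_eq ha hinv hB hB'

end Torus

/-! ### Joint spectral measures of commuting unitary operators -/

open WeakDual in
theorem exists_starAlgHom_unitAddTorus_of_comm {ι A : Type*} [CommCStarAlgebra A]
    (u : ι → unitary A) :
    ∃ φ : C(UnitAddTorus ι, ℂ) →⋆ₐ[ℂ] A,
      ∀ i, φ ((fourier 1).comp (ContinuousMap.eval i)) = u i := by
  have h_circle (χ : characterSpace ℂ A) (i : ι) : χ (u i) ∈ Submonoid.unitSphere ℂ :=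
    mem_sphere_zero_iff_norm.2 (CStarRing.norm_of_mem_unitary (Unitary.map_mem χ (u i).2))
  let z (i : ι) (χ : characterSpace ℂ A) : Circle := ⟨χ (u i), h_circle χ i⟩
  have hz (i : ι) : Continuous (z i) :=
    (gelfandTransform ℂ A (u i)).continuous.subtype_mk _
  -- The image of `θ` is the joint spectrum of the `u i`.
  let θ : C(characterSpace ℂ A, UnitAddTorus ι) :=
    ⟨fun χ i => (AddCircle.homeomorphCircle one_ne_zero).symm (z i χ), by fun_prop⟩
  refine ⟨((gelfandStarTransform A).symm : C(characterSpace ℂ A, ℂ) →⋆ₐ[ℂ] A).comp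
    (θ.compStarAlgHom' ℂ ℂ), fun i => ?_⟩
  suffices ((fourier 1).comp (ContinuousMap.eval i)).comp θ = gelfandStarTransform A (u i) from
    (congrArg _ this).trans ((gelfandStarTransform A).symm_apply_apply _)
  ext χ
  have h := (AddCircle.homeomorphCircle (T := 1) one_ne_zero).apply_symm_apply (z i χ)
  rw [AddCircle.homeomorphCircle_apply] at h
  exact fourier_one.trans (congrArg Subtype.val h)

theorem map_fourier_comp_eq_zpow {X C : Type*} [TopologicalSpace X] [Ring C] [StarRing C]
    [Algebra ℂ C] {φ : C(X, ℂ) →⋆ₐ[ℂ] C} {F : C(X, UnitAddCircle)} {u : unitary C}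
    (h : φ ((fourier 1).comp F) = u) (n : ℤ) : φ ((fourier n).comp F) = (u ^ n : unitary C) := by
  let f : Multiplicative ℤ →* C :=
    { toFun n := φ ((fourier n.toAdd).comp F)
      map_one' := by
        rw [← map_one φ]
        congr 1
        ext
        exact fourier_zero
      map_mul' m n := by
        rw [← map_mul]
        congr 1
        ext
        exact fourier_add }
  have hfg : f = (unitary C).subtype.comp (zpowersHom _ u) :=
    MonoidHom.ext_mint (h.trans (by simp))
  exact (DFunLike.congr_fun hfg (Multiplicative.ofAdd n)).trans (by simp)

theorem exists_starAlgHom_unitAddTorus {ι C : Type*} [CStarAlgebra C] (u : ι → unitary C)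
    (hu : ∀ i j, Commute (u i) (u j)) :
    ∃ φ : C(UnitAddTorus ι, ℂ) →⋆ₐ[ℂ] C,
      ∀ i, φ ((fourier 1).comp (ContinuousMap.eval i)) = u i := by
  let s : Set C := range fun i => (u i : C)
  have hs : IsMulCommutative (StarAlgebra.adjoin ℂ s) := by
    refine StarAlgebra.isMulCommutative_adjoin ℂ ?_ ?_
    · rintro _ ⟨i, rfl⟩ _ ⟨j, rfl⟩
      exact congrArg Subtype.val (hu i j)
    · rintro _ ⟨i, rfl⟩ _ ⟨j, rfl⟩
      exact congrArg Subtype.val (hu i j).inv_right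
  let A := (StarAlgebra.adjoin ℂ s).topologicalClosure
  have : IsClosed (A : Set C) := StarSubalgebra.isClosed_topologicalClosure _
  let : CommCStarAlgebra A :=
    { (inferInstance : CStarAlgebra A) with
      mul_comm := (StarSubalgebra.commRingTopologicalClosure _ fun x y => mul_comm' x y).mul_comm }
  have hA (i : ι) : (u i : C) ∈ A :=
    StarSubalgebra.le_topologicalClosure _ (StarAlgebra.subset_adjoin ℂ s ⟨i, rfl⟩)
  let v (i : ι) : unitary A :=
    ⟨⟨u i, hA i⟩, Subtype.ext (u i).2.1, Subtype.ext (u i).2.2⟩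
  obtain ⟨φ, hφ⟩ := exists_starAlgHom_unitAddTorus_of_comm v
  exact ⟨A.subtype.comp φ, fun i => congrArg Subtype.val (hφ i)⟩

section SpectralMeasure

variable {X : Type*} [TopologicalSpace X] [CompactSpace X] [T2Space X] [MeasurableSpace X]
  [BorelSpace X]

theorem exists_measure_integral_eq (Λ : C(X, ℂ) →ₚ[ℂ] ℂ) :
    ∃ μ : Measure X, IsFiniteMeasure μ ∧ ∀ f : C(X, ℂ), Λ f = ∫ x, f x ∂μ := by
  let ι : C(X, ℝ) →ₐ[ℝ] C(X, ℂ) := Complex.ofRealAm.compLeftContinuous ℝ Complex.continuous_ofReal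
  have hΛι (f : C(X, ℝ)) : ((Λ (ι f)).re : ℂ) = Λ (ι f) := by
    refine Complex.conj_eq_iff_re.1 ?_
    rw [← Complex.star_def, ← map_star]
    congr 1
    ext x
    exact Complex.conj_ofReal (f x)
  let L : C(X, ℝ) →ₗ[ℝ] ℝ := Complex.reLm ∘ₗ Λ.toLinearMap.restrictScalars ℝ ∘ₗ ι.toLinearMap
  let Λr : CompactlySupportedContinuousMap X ℝ →ₚ[ℝ] ℝ := .mk₀
    { toFun f := L f
      map_add' f g := L.map_add f g
      map_smul' a f := L.map_smul a f }
    fun f hf => (Complex.nonneg_iff.1 (map_nonneg Λ (a := ι f)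
      fun x => Complex.zero_le_real.2 (hf x))).1
  let μ := RealRMK.rieszMeasure Λr
  refine ⟨μ, inferInstance, fun f => ?_⟩
  have hι (g : C(X, ℝ)) : Λ (ι g) = ∫ x, ι g x ∂μ := by
    have := RealRMK.integral_rieszMeasure Λr (CompactlySupportedContinuousMap.continuousMapEquiv g)
    rw [← hΛι]
    exact (congrArg Complex.ofReal this.symm).trans integral_complex_ofReal.symm
  have hf : f = ι ⟨fun x => (f x).re, by fun_prop⟩ +
      Complex.I • ι ⟨fun x => (f x).im, by fun_prop⟩ := by
    ext x
    exact (Complex.re_add_im (f x)).symm.trans (by rw [mul_comm]; rfl)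
  rw [hf, map_add, map_smul, hι, hι, smul_eq_mul, ← integral_const_mul, ← integral_add
    (integrable_continuousMap _ _) ((integrable_continuousMap _ _).const_mul _)]
  rfl

variable {H : Type*} [NormedAddCommGroup H] [InnerProductSpace ℂ H] [CompleteSpace H]

/-- The positive functional `f ↦ ⟪ψ, φ f ψ⟫` of a representation `φ` of `C(X, ℂ)`. -/
def vectorFunctional (φ : C(X, ℂ) →⋆ₐ[ℂ] (H →L[ℂ] H)) (ψ : H) : C(X, ℂ) →ₚ[ℂ] ℂ :=
  .mk₀ ((innerSL ℂ ψ).toLinearMap ∘ₗ (ContinuousLinearMap.apply ℂ H ψ).toLinearMap ∘ₗ φ.toLinearMap)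
    fun _ hf =>
      ((ContinuousLinearMap.nonneg_iff_isPositive _).1 (map_nonneg φ hf)).inner_nonneg_right ψ

/-- The joint spectral measure at `ψ` of a representation `φ` of `C(X, ℂ)`: a finite measure
representing `vectorFunctional φ ψ`. -/
def spectralMeasure (φ : C(X, ℂ) →⋆ₐ[ℂ] (H →L[ℂ] H)) (ψ : H) : Measure X :=
  (exists_measure_integral_eq (vectorFunctional φ ψ)).choose

variable (φ : C(X, ℂ) →⋆ₐ[ℂ] (H →L[ℂ] H))

instance (ψ : H) : IsFiniteMeasure (spectralMeasure φ ψ) :=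
  (exists_measure_integral_eq (vectorFunctional φ ψ)).choose_spec.1

theorem inner_eq_integral_spectralMeasure (ψ : H) (f : C(X, ℂ)) :
    ⟪ψ, φ f ψ⟫_ℂ = ∫ x, f x ∂spectralMeasure φ ψ :=
  (exists_measure_integral_eq (vectorFunctional φ ψ)).choose_spec.2 f

theorem spectralMeasure_univ (ψ : H) : spectralMeasure φ ψ univ = ‖ψ‖ₑ ^ 2 := by
  have h := inner_eq_integral_spectralMeasure φ ψ 1
  simp only [map_one, one_apply_eq_self, inner_self_eq_norm_sq_to_K,
    ContinuousMap.one_apply, integral_const] at h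
  have hreal : (spectralMeasure φ ψ).real univ = ‖ψ‖ ^ 2 := by
    simpa [← Complex.ofReal_pow] using (congrArg Complex.re h).symm
  rw [← ofReal_measureReal, hreal, ENNReal.ofReal_pow (norm_nonneg ψ), ofReal_norm]

theorem ae_eq_spectralMeasure_of_map_eq {f g : C(X, ℂ)} (h : φ f = φ g) (ψ : H) :
    f =ᵐ[spectralMeasure φ ψ] g := by
  let d : C(X, ℝ) := ⟨fun x => Complex.normSq (f x - g x), by fun_prop⟩
  have hd : ∫ x, d x ∂spectralMeasure φ ψ = 0 := by
    have hφ : φ (star (f - g) * (f - g)) = 0 := by rw [map_mul, map_sub, h, sub_self, mul_zero]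
    have hstar (x : X) : (star (f - g) * (f - g)) x = (d x : ℂ) :=
      Complex.normSq_eq_conj_mul_self.symm
    have hinner := inner_eq_integral_spectralMeasure φ ψ (star (f - g) * (f - g))
    simp only [hφ, zero_apply, inner_zero_right, hstar, integral_complex_ofReal] at hinner
    exact_mod_cast hinner.symm
  have hd_ae := (integral_eq_zero_iff_of_nonneg (fun x => Complex.normSq_nonneg _)
    (integrable_continuousMap _ d)).1 hd
  filter_upwards [hd_ae] with x hx
  exact sub_eq_zero.1 (Complex.normSq_eq_zero.1 hx)

variable [HasOuterApproxClosed X]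

theorem spectralMeasure_smul (c : ℂ) (ψ : H) :
    spectralMeasure φ (c • ψ) = (‖c‖₊ ^ 2) • spectralMeasure φ ψ := by
  refine measure_ext_of_integral_continuousMap fun f => ?_
  rw [integral_smul_nnreal_measure, ← inner_eq_integral_spectralMeasure,
    ← inner_eq_integral_spectralMeasure, map_smul, inner_smul_left, inner_smul_right,
    NNReal.smul_def, Complex.real_smul, ← mul_assoc, ← Complex.normSq_eq_conj_mul_self,
    Complex.normSq_eq_norm_sq]
  simp

theorem spectralMeasure_parallelogram (a b : H) :
    spectralMeasure φ (a + b) + spectralMeasure φ (a - b) =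
      (2 : NNReal) • (spectralMeasure φ a + spectralMeasure φ b) := by
  refine measure_ext_of_integral_continuousMap fun f => ?_
  rw [integral_add_measure (integrable_continuousMap _ f) (integrable_continuousMap _ f),
    integral_smul_nnreal_measure,
    integral_add_measure (integrable_continuousMap _ f) (integrable_continuousMap _ f)]
  simp only [← inner_eq_integral_spectralMeasure, map_add, map_sub, inner_add_left,
    inner_add_right, inner_sub_left, inner_sub_right, NNReal.smul_def, Complex.real_smul]
  push_cast
  ring

theorem spectralMeasure_add_le (a b : H) :
    spectralMeasure φ (a + b) ≤ (2 : NNReal) • (spectralMeasure φ a + spectralMeasure φ b) :=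
  spectralMeasure_parallelogram φ a b ▸ Measure.le_add_right le_rfl

/-- The subspace of the vectors whose spectral measure vanishes on `B`, i.e. the kernel of the
spectral projection of `B`. -/
def nullSubspace (B : Set X) : Submodule ℂ H where
  carrier := {ψ | spectralMeasure φ ψ B = 0}
  zero_mem' := measure_mono_null (subset_univ B) (by simp [spectralMeasure_univ])
  add_mem' {a b} (ha : spectralMeasure φ a B = 0) (hb : spectralMeasure φ b B = 0) :=
    nonpos_iff_eq_zero.1 <| (spectralMeasure_add_le φ a b B).trans_eq <| by simp [ha, hb]
  smul_mem' c ψ (hψ : spectralMeasure φ ψ B = 0) := show spectralMeasure φ (c • ψ) B = 0 by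
    rw [spectralMeasure_smul, Measure.smul_apply, hψ, smul_zero]

theorem isClosed_nullSubspace (B : Set X) : IsClosed (nullSubspace φ B : Set H) := by
  refine IsSeqClosed.isClosed fun χ ψ hχ hlim => ?_
  have hle (n : ℕ) : spectralMeasure φ ψ B ≤ (2 : NNReal) • ‖ψ - χ n‖ₑ ^ 2 := by
    calc spectralMeasure φ ψ B
      _ = spectralMeasure φ (χ n + (ψ - χ n)) B := by rw [add_sub_cancel]
      _ ≤ (2 : NNReal) • (spectralMeasure φ (χ n) B + spectralMeasure φ (ψ - χ n) B) :=
        spectralMeasure_add_le φ _ _ B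
      _ ≤ (2 : NNReal) • ‖ψ - χ n‖ₑ ^ 2 := by
        rw [show spectralMeasure φ (χ n) B = 0 from hχ n, zero_add, ← spectralMeasure_univ φ]
        gcongr
        exact subset_univ B
  have hlim0 : Tendsto (fun n => (2 : NNReal) • ‖ψ - χ n‖ₑ ^ 2) atTop (nhds 0) := by
    have hcont : Continuous fun χ => (2 : NNReal) • ‖ψ - χ‖ₑ ^ 2 :=
      (ENNReal.continuous_const_mul (by simp)).comp
        ((ENNReal.continuous_pow 2).comp (by fun_prop))
    simpa [Function.comp_def] using (hcont.tendsto ψ).comp hlim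
  exact nonpos_iff_eq_zero.1 (ge_of_tendsto' hlim0 hle)

variable {φ} in
theorem spectralMeasure_eq_zero_of_total {s : Set H}
    (hs : (Submodule.span ℂ s).topologicalClosure = ⊤) {B : Set X}
    (h : ∀ ψ ∈ s, spectralMeasure φ ψ B = 0) (ψ : H) : spectralMeasure φ ψ B = 0 :=
  (Submodule.topologicalClosure_minimal _ (Submodule.span_le.2 h : _ ≤ nullSubspace φ B)
    (isClosed_nullSubspace φ B)) (hs ▸ Submodule.mem_top)

variable {φ} in
theorem hasPurelyACSpectrum_of_forall_map_absolutelyContinuous {U : H ≃ₗᵢ[ℂ] H}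
    {F : C(X, UnitAddCircle)} (hF : ∀ (n : ℤ) (ψ : H), φ ((fourier n).comp F) ψ = (U ^ n) ψ)
    {s : Set H} (hs : (Submodule.span ℂ s).topologicalClosure = ⊤)
    (h : ∀ ψ ∈ s, (spectralMeasure φ ψ).map F ≪ volume) : HasPurelyACSpectrum U := by
  have hFm := F.continuous.measurable
  refine eq_univ_of_forall fun ψ => ⟨(spectralMeasure φ ψ).map F, ⟨inferInstance, fun n => ?_⟩,
    Measure.AbsolutelyContinuous.mk fun N hN h0 => ?_⟩
  · rw [integral_map hFm.aemeasurable (by fun_prop), ← hF]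
    exact inner_eq_integral_spectralMeasure φ ψ ((fourier n).comp F)
  · rw [Measure.map_apply hFm hN]
    refine spectralMeasure_eq_zero_of_total hs (fun χ hχ => ?_) ψ
    rw [← Measure.map_apply hFm hN]
    exact h χ hχ h0

end SpectralMeasure

theorem exists_starAlgHom_fourier_comp_eval_eq_zpow {ι H : Type*} [NormedAddCommGroup H]
    [InnerProductSpace ℂ H] [CompleteSpace H] {W : ι → H ≃ₗᵢ[ℂ] H}
    (hW : ∀ i j, Commute (W i) (W j)) :
    ∃ φ : C(UnitAddTorus ι, ℂ) →⋆ₐ[ℂ] (H →L[ℂ] H), ∀ (i : ι) (n : ℤ) (ψ : H),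
      φ ((fourier n).comp (ContinuousMap.eval i)) ψ = (W i ^ n) ψ := by
  let toUnitary := (Unitary.linearIsometryEquiv (𝕜 := ℂ) (H := H)).symm
  obtain ⟨φ, hφ⟩ := exists_starAlgHom_unitAddTorus (fun i => toUnitary (W i))
    fun i j => (hW i j).map toUnitary
  refine ⟨φ, fun i n ψ => ?_⟩
  rw [map_fourier_comp_eq_zpow (hφ i), ← map_zpow, Unitary.coe_symm_linearIsometryEquiv_apply]
  rfl

section Criterion

variable {Ω : Type*} [MeasurableSpace Ω] {μ : Measure Ω} [IsFiniteMeasure μ]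
  {X Y Z : Ω → UnitAddCircle}

theorem measure_sub_circleSin_mem_eq_zero (hY : Measurable Y) (hZ : Measurable Z)
    (hYZ : ∀ i j : ℤ, i ≠ 0 → ∫ ω, fourier i (Y ω) * fourier j (Z ω) ∂μ = 0)
    {g : UnitAddCircle → ℝ} (hg : Measurable g) {n : ℤ} (hn : n ≠ 0) {M : Set ℝ}
    (hM : MeasurableSet M) (hM0 : volume M = 0) :
    μ {ω | g (Z ω) - circleSin n (Y ω) ∈ M} = 0 := by
  let W (ω : Ω) : UnitAddTorus (Fin 2) := ![Y ω, Z ω]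
  have hW : Measurable W := measurable_pi_iff.2 (Fin.forall_fin_two.2 ⟨hY, hZ⟩)
  let B : Set (UnitAddTorus (Fin 2)) := {x | g (x 1) - circleSin n (x 0) ∈ M}
  have hB : MeasurableSet B := by
    refine measurableSet_preimage (Measurable.sub ?_ ?_) hM
    · exact hg.comp (measurable_pi_apply 1)
    · exact (circleSin n).continuous.measurable.comp (measurable_pi_apply 0)
  have hfourier (k : Fin 2 → ℤ) (hk : k 0 ≠ 0) : ∫ x, UnitAddTorus.mFourier k x ∂μ.map W = 0 := by
    rw [integral_map hW.aemeasurable (by fun_prop)]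
    refine (integral_congr_ae (ae_of_all _ fun ω => ?_)).trans (hYZ (k 0) (k 1) hk)
    exact Fin.prod_univ_two fun i => fourier (k i) (W ω i)
  have hnull : μ.map W B = 0 := by
    refine measure_eq_zero_of_integral_mFourier_eq_zero hfourier hB fun x => ?_
    refine Eq.trans (congrArg _ (ext fun θ => ?_))
      (volume_preimage_sub_circleSin_eq_zero hn hM0 (g (x 1)) (x 0))
    simp [B]
  rwa [Measure.map_apply hW hB] at hnull

theorem map_absolutelyContinuous_of_circleSin_eq (hX : Measurable X) (hY : Measurable Y)
    (hZ : Measurable Z) (hYZ : ∀ i j : ℤ, i ≠ 0 → ∫ ω, fourier i (Y ω) * fourier j (Z ω) ∂μ = 0)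
    {a : ℝ} {k n : ℤ} (hn : n ≠ 0) {g : UnitAddCircle → ℝ} (hg : Measurable g)
    (hXYZ : ∀ᵐ ω ∂μ, a * circleSin k (X ω) = g (Z ω) - circleSin n (Y ω)) :
    μ.map X ≪ volume := by
  refine Measure.AbsolutelyContinuous.mk fun N hN hN0 => ?_
  let M := (a * ·) '' (circleSin k '' N)
  have hM : volume (toMeasurable volume M) = 0 := by
    rw [measure_toMeasurable]
    exact addHaar_image_eq_zero_of_differentiableOn_of_addHaar_eq_zero volume (by fun_prop)
      (volume_image_circleSin_eq_zero k hN0)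
  rw [Measure.map_apply hX hN]
  refine measure_mono_null_ae ?_
    (measure_sub_circleSin_mem_eq_zero hY hZ hYZ hg hn (measurableSet_toMeasurable _ _) hM)
  filter_upwards [hXYZ] with ω hω hωN
  change g (Z ω) - circleSin n (Y ω) ∈ _
  rw [← hω]
  exact subset_toMeasurable _ _ (mem_image_of_mem _ (mem_image_of_mem _ hωN))

end Criterion

theorem hasPurelyACSpectrum_of_zpow_sub_zpow_neg_eq {H : Type*} [NormedAddCommGroup H]
    [InnerProductSpace ℂ H] [CompleteSpace H] {U T V : H ≃ₗᵢ[ℂ] H} (hUT : Commute U T)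
    (hUV : Commute U V) (hTV : Commute T V) {a : ℝ} {k : ℤ}
    (h : ∀ ψ, (a : ℂ) • ((U ^ k) ψ - (U ^ (-k)) ψ) = (V ψ - V.symm ψ) - (T ψ - T.symm ψ))
    {s : Set H} (hs : (Submodule.span ℂ s).topologicalClosure = ⊤)
    (horth : ∀ ψ ∈ s, ∀ i j : ℤ, i ≠ 0 → ⟪ψ, (T ^ i) ((V ^ j) ψ)⟫_ℂ = 0) :
    HasPurelyACSpectrum U := by
  let W : Fin 3 → H ≃ₗᵢ[ℂ] H := ![U, T, V]
  have hW (i j : Fin 3) : Commute (W i) (W j) := by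
    fin_cases i <;> fin_cases j <;>
      first | exact Commute.refl _ | assumption | exact Commute.symm (by assumption)
  obtain ⟨φ, hφ⟩ := exists_starAlgHom_fourier_comp_eval_eq_zpow hW
  let F (i : Fin 3) : C(UnitAddTorus (Fin 3), UnitAddCircle) := ContinuousMap.eval i
  have hF (i : Fin 3) : Measurable (F i) := (F i).continuous.measurable
  refine hasPurelyACSpectrum_of_forall_map_absolutelyContinuous (hφ 0) hs fun ψ hψ => ?_
  refine map_absolutelyContinuous_of_circleSin_eq (hF 0) (hF 1) (hF 2) (fun i j hi => ?_)
    (a := a) (k := k) one_ne_zero (circleSin 1).continuous.measurable ?_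
  · have hTV : φ ((fourier i).comp (F 1) * (fourier j).comp (F 2)) ψ = (T ^ i) ((V ^ j) ψ) := by
      rw [map_mul, mul_apply_eq_comp, hφ, hφ]
      rfl
    rw [← horth ψ hψ i j hi, ← hTV, inner_eq_integral_spectralMeasure]
    rfl
  · let D (i : Fin 3) (n : ℤ) : C(UnitAddTorus (Fin 3), ℂ) :=
      (fourier n).comp (F i) - (fourier (-n)).comp (F i)
    have hD : φ ((a : ℂ) • D 0 k) = φ (D 2 1 - D 1 1) := by
      ext ψ
      simp only [D, F, map_smul, map_sub, smul_apply, sub_apply, hφ]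
      exact h ψ
    filter_upwards [ae_eq_spectralMeasure_of_map_eq φ hD ψ] with x hx
    have hx' : ((a * circleSin k (F 0 x) : ℝ) : ℂ) =
        (circleSin 1 (F 2 x) - circleSin 1 (F 1 x) : ℝ) := by
      refine mul_left_cancel₀ (mul_ne_zero two_ne_zero Complex.I_ne_zero) ?_
      simp only [D, ContinuousMap.smul_apply, ContinuousMap.sub_apply, ContinuousMap.comp_apply,
        fourier_sub_fourier_neg, smul_eq_mul] at hx
      push_cast
      linear_combination hx
    exact_mod_cast hx'

namespace ChalkerCoddington

/-! ### The homogeneous network -/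

section Translation

variable {A : Type*} [DecidableEq A]

/-- The canonical basis of `ℓ²(ℤ × A)` as a Hilbert basis. -/
def canonicalBasis : HilbertBasis (ℤ × A) ℂ (L2 A) := .ofRepr (.refl ℂ _)

theorem coe_canonicalBasis : ⇑(canonicalBasis (A := A)) = e :=
  funext fun ν => (canonicalBasis.repr_symm_single ν).symm

theorem span_range_e_topologicalClosure :
    (Submodule.span ℂ (range (e : ℤ × A → L2 A))).topologicalClosure = ⊤ :=
  coe_canonicalBasis (A := A) ▸ canonicalBasis.dense_span

theorem continuousLinearMap_ext_e {F : Type*} [NormedAddCommGroup F] [NormedSpace ℂ F]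
    {f g : L2 A →L[ℂ] F} (h : ∀ ν, f (e ν) = g (e ν)) : f = g :=
  ContinuousLinearMap.ext_on
    (Submodule.dense_iff_topologicalClosure_eq_top.2 span_range_e_topologicalClosure)
    (forall_mem_range.2 h)

theorem commute_of_forall_e {U V : L2 A ≃ₗᵢ[ℂ] L2 A} (h : ∀ ν, U (V (e ν)) = V (U (e ν))) :
    Commute U V := by
  have hUV : (U * V : L2 A ≃ₗᵢ[ℂ] L2 A).toContinuousLinearEquiv.toContinuousLinearMap =
      (V * U : L2 A ≃ₗᵢ[ℂ] L2 A).toContinuousLinearEquiv.toContinuousLinearMap :=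
    continuousLinearMap_ext_e h
  exact LinearIsometryEquiv.ext fun ψ => DFunLike.congr_fun hUV ψ

variable [AddCommGroup A]

/-- The translation by `a` on `ℓ²(ℤ × A)`, as a unitary operator; it sends `e ν` to `e (ν + a)`. -/
def translation (a : ℤ × A) : L2 A ≃ₗᵢ[ℂ] L2 A :=
  (HilbertBasis.mk (v := fun ν : ℤ × A => (e (ν + a) : L2 A))
    ((coe_canonicalBasis (A := A) ▸ canonicalBasis.orthonormal).comp _ (add_left_injective a))
    (by
      have hrange : range (fun ν : ℤ × A => (e (ν + a) : L2 A)) = range e :=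
        (Equiv.addRight a).surjective.range_comp e
      exact hrange ▸ span_range_e_topologicalClosure.ge)).repr.symm

theorem translation_e (a ν : ℤ × A) : translation a (e ν) = e (ν + a) := by
  rw [translation, e, HilbertBasis.repr_symm_single, HilbertBasis.coe_mk]

theorem translation_symm_e (a ν : ℤ × A) : (translation a).symm (e ν) = e (ν - a) := by
  rw [LinearIsometryEquiv.symm_apply_eq, translation_e, sub_add_cancel]

theorem translation_zpow_e (a ν : ℤ × A) (n : ℤ) : (translation a ^ n) (e ν) = e (ν + n • a) := by
  induction n generalizing ν with
  | zero => simp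
  | succ n ih =>
    rw [zpow_add_one, LinearIsometryEquiv.coe_mul, Function.comp_apply, translation_e, ih]
    congr 1
    module
  | pred n ih =>
    rw [zpow_sub_one, LinearIsometryEquiv.coe_mul, Function.comp_apply,
      LinearIsometryEquiv.coe_inv, translation_symm_e, ih]
    congr 1
    module

theorem commute_translation (a b : ℤ × A) : Commute (translation a) (translation b) :=
  commute_of_forall_e fun ν => by simp only [translation_e, add_right_comm]

theorem inner_e_translation_zpow_e {a b ν : ℤ × A} {i j : ℤ} (h : i • a + j • b ≠ 0) :
    ⟪e ν, (translation a ^ i) ((translation b ^ j) (e ν))⟫_ℂ = 0 := by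
  rw [translation_zpow_e, translation_zpow_e, inner_e_left, e_apply, if_neg]
  rwa [add_assoc, add_comm (j • b), left_eq_add]

end Translation

section Network

theorem S_one (r t : ℝ) : S r t 1 = !![(t : ℂ), -r; r, t] := by
  ext i j
  fin_cases i <;> fin_cases j <;> simp [S]

theorem pe_one {A : Type*} (x : ℤ × A) : pe (fun _ _ => 1) x = 1 := by
  ext i
  fin_cases i <;> simp [pe]

theorem po_one {A : Type*} (x : ℤ × A) : po (fun _ _ => 1) x = 1 := by
  ext i
  fin_cases i <;> simp [po]

theorem even_add_iff_of_even {A : Type*} [Ring A] {a b : A} (hb : Even b) :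
    Even (a + b) ↔ Even a :=
  ⟨fun h => add_sub_cancel_right a b ▸ h.sub hb, fun h => h.add hb⟩

theorem HasParity.not_even_add_one {A : Type*} [CommRing A] [HasParity A] {a : A} (ha : Even a) :
    ¬ Even (a + 1) :=
  fun h => (even_add_one a).1 h ha

theorem HasParity.not_even_sub_one {A : Type*} [CommRing A] [HasParity A] {a : A} (ha : Even a) :
    ¬ Even (a - 1) :=
  fun h => (even_sub_one a).1 h ha

variable {A : Type*} [CommRing A] [DecidableEq A] [HasParity A] {r t : ℝ} (h : r ^ 2 + t ^ 2 = 1)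
  {m : ℤ} {n : A}

open HasParity

variable (A) in
/-- The network operator on `ℓ²(ℤ × A)` all of whose phases are equal to `1`. -/
abbrev homogeneousNetwork : L2 A ≃ₗᵢ[ℂ] L2 A := network r t h fun _ _ => 1

theorem homogeneousNetwork_ee (hm : Even m) (hn : Even n) :
    homogeneousNetwork A h (e (m, n)) = (t : ℂ) • e (m + 1, n) + (r : ℂ) • e (m, n + 1) := by
  rw [network_e, column_ee hm hn, pe_one, S_one]
  simp

theorem homogeneousNetwork_eo (hm : Even m) (hn : ¬ Even n) :
    homogeneousNetwork A h (e (m, n)) = (t : ℂ) • e (m, n + 1) + (r : ℂ) • e (m - 1, n) := by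
  rw [network_e, column_eo hm hn, po_one, S_one]
  simp

theorem homogeneousNetwork_oe (hm : ¬ Even m) (hn : Even n) :
    homogeneousNetwork A h (e (m, n)) = -(r : ℂ) • e (m + 1, n) + (t : ℂ) • e (m, n - 1) := by
  rw [network_e, column_oe hm hn, po_one, S_one]
  simp

theorem homogeneousNetwork_oo (hm : ¬ Even m) (hn : ¬ Even n) :
    homogeneousNetwork A h (e (m, n)) = -(r : ℂ) • e (m, n - 1) + (t : ℂ) • e (m - 1, n) := by
  rw [network_e, column_oo hm hn, pe_one, S_one]
  simp

theorem homogeneousNetwork_symm_ee (hm : Even m) (hn : Even n) :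
    (homogeneousNetwork A h).symm (e (m, n)) =
      (t : ℂ) • e (m, n - 1) - (r : ℂ) • e (m - 1, n) := by
  have hC : (r : ℂ) ^ 2 + (t : ℂ) ^ 2 = 1 := by exact_mod_cast h
  rw [LinearIsometryEquiv.symm_apply_eq, map_sub, map_smul, map_smul,
    homogeneousNetwork_eo h hm (not_even_sub_one hn),
    homogeneousNetwork_oe h (not_even_sub_one hm) hn, sub_add_cancel, sub_add_cancel]
  linear_combination (norm := module) -hC • (e (m, n) : L2 A)

theorem homogeneousNetwork_symm_eo (hm : Even m) (hn : ¬ Even n) :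
    (homogeneousNetwork A h).symm (e (m, n)) =
      (r : ℂ) • e (m, n - 1) + (t : ℂ) • e (m + 1, n) := by
  have hC : (r : ℂ) ^ 2 + (t : ℂ) ^ 2 = 1 := by exact_mod_cast h
  rw [LinearIsometryEquiv.symm_apply_eq, map_add, map_smul, map_smul,
    homogeneousNetwork_ee h hm ((even_sub_one n).2 hn),
    homogeneousNetwork_oo h (not_even_add_one hm) hn, sub_add_cancel, add_sub_cancel_right]
  linear_combination (norm := module) -hC • (e (m, n) : L2 A)

theorem homogeneousNetwork_symm_oe (hm : ¬ Even m) (hn : Even n) :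
    (homogeneousNetwork A h).symm (e (m, n)) =
      (t : ℂ) • e (m - 1, n) - (r : ℂ) • e (m, n + 1) := by
  have hC : (r : ℂ) ^ 2 + (t : ℂ) ^ 2 = 1 := by exact_mod_cast h
  rw [LinearIsometryEquiv.symm_apply_eq, map_sub, map_smul, map_smul,
    homogeneousNetwork_ee h ((even_sub_one m).2 hm) hn,
    homogeneousNetwork_oo h hm (not_even_add_one hn), sub_add_cancel, add_sub_cancel_right]
  linear_combination (norm := module) -hC • (e (m, n) : L2 A)

theorem homogeneousNetwork_symm_oo (hm : ¬ Even m) (hn : ¬ Even n) :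
    (homogeneousNetwork A h).symm (e (m, n)) =
      (r : ℂ) • e (m + 1, n) + (t : ℂ) • e (m, n + 1) := by
  have hC : (r : ℂ) ^ 2 + (t : ℂ) ^ 2 = 1 := by exact_mod_cast h
  rw [LinearIsometryEquiv.symm_apply_eq, map_add, map_smul, map_smul,
    homogeneousNetwork_eo h ((even_add_one m).2 hm) hn,
    homogeneousNetwork_oe h hm ((even_add_one n).2 hn), add_sub_cancel_right,
    add_sub_cancel_right]
  linear_combination (norm := module) -hC • (e (m, n) : L2 A)

theorem homogeneousNetwork_sq_sub_symm_sq_e (m : ℤ) (n : A) :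
    homogeneousNetwork A h (homogeneousNetwork A h (e (m, n))) -
        (homogeneousNetwork A h).symm ((homogeneousNetwork A h).symm (e (m, n))) =
      ((r * t : ℝ) : ℂ) • (e (m, n + 2) - e (m, n - 2) - (e (m + 2, n) - e (m - 2, n))) := by
  rw [show m + 2 = m + 1 + 1 by ring, show m - 2 = m - 1 - 1 by ring,
    show n + 2 = n + 1 + 1 by ring, show n - 2 = n - 1 - 1 by ring, Complex.ofReal_mul]
  by_cases hm : Even m <;> by_cases hn : Even n
  · rw [homogeneousNetwork_ee h hm hn, homogeneousNetwork_symm_ee h hm hn]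
    simp only [map_add, map_sub, map_smul, homogeneousNetwork_oe h (not_even_add_one hm) hn,
      homogeneousNetwork_eo h hm (not_even_add_one hn),
      homogeneousNetwork_symm_eo h hm (not_even_sub_one hn),
      homogeneousNetwork_symm_oe h (not_even_sub_one hm) hn]
    module
  · rw [homogeneousNetwork_eo h hm hn, homogeneousNetwork_symm_eo h hm hn]
    simp only [map_add, map_smul, homogeneousNetwork_ee h hm ((even_add_one n).2 hn),
      homogeneousNetwork_oo h (not_even_sub_one hm) hn,
      homogeneousNetwork_symm_ee h hm ((even_sub_one n).2 hn),
      homogeneousNetwork_symm_oo h (not_even_add_one hm) hn]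
    module
  · rw [homogeneousNetwork_oe h hm hn, homogeneousNetwork_symm_oe h hm hn]
    simp only [map_add, map_sub, map_smul, homogeneousNetwork_ee h ((even_add_one m).2 hm) hn,
      homogeneousNetwork_oo h hm (not_even_sub_one hn),
      homogeneousNetwork_symm_ee h ((even_sub_one m).2 hm) hn,
      homogeneousNetwork_symm_oo h hm (not_even_add_one hn)]
    module
  · rw [homogeneousNetwork_oo h hm hn, homogeneousNetwork_symm_oo h hm hn]
    simp only [map_add, map_smul, homogeneousNetwork_oe h hm ((even_sub_one n).2 hn),
      homogeneousNetwork_eo h ((even_sub_one m).2 hm) hn,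
      homogeneousNetwork_symm_eo h ((even_add_one m).2 hm) hn,
      homogeneousNetwork_symm_oe h hm ((even_add_one n).2 hn)]
    module

theorem homogeneousNetwork_sq_sub_symm_sq (ψ : L2 A) :
    homogeneousNetwork A h (homogeneousNetwork A h ψ) -
        (homogeneousNetwork A h).symm ((homogeneousNetwork A h).symm ψ) =
      ((r * t : ℝ) : ℂ) • (translation (0, 2) ψ - (translation (0, 2)).symm ψ -
        (translation (2, 0) ψ - (translation (2, 0)).symm ψ)) := by
  let op (U : L2 A ≃ₗᵢ[ℂ] L2 A) : L2 A →L[ℂ] L2 A := U.toContinuousLinearEquiv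
  let U := homogeneousNetwork A h
  let T (a : ℤ × A) : L2 A →L[ℂ] L2 A := op (translation a) - op (translation a).symm
  have hUT : op (U * U) - op (U.symm * U.symm) =
      ((r * t : ℝ) : ℂ) • (T (0, 2) - T (2, 0)) := by
    refine continuousLinearMap_ext_e fun ⟨m, n⟩ => ?_
    refine (homogeneousNetwork_sq_sub_symm_sq_e h m n).trans ?_
    simp [T, op, translation_e, translation_symm_e]
  exact DFunLike.congr_fun hUT ψ

theorem commute_homogeneousNetwork_translation {a : ℤ} {b : A} (ha : Even a) (hb : Even b) :
    Commute (homogeneousNetwork A h) (translation (a, b)) := by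
  refine commute_of_forall_e fun ⟨m, n⟩ => ?_
  have hma : Even (m + a) ↔ Even m := even_add_iff_of_even ha
  have hnb : Even (n + b) ↔ Even n := even_add_iff_of_even hb
  rw [translation_e, Prod.mk_add_mk]
  by_cases hm : Even m <;> by_cases hn : Even n
  · rw [homogeneousNetwork_ee h hm hn, homogeneousNetwork_ee h (hma.2 hm) (hnb.2 hn)]
    simp only [map_add, map_smul, translation_e, Prod.mk_add_mk, add_right_comm]
  · rw [homogeneousNetwork_eo h hm hn, homogeneousNetwork_eo h (hma.2 hm) (mt hnb.1 hn)]
    simp only [map_add, map_smul, translation_e, Prod.mk_add_mk, add_right_comm, sub_add_eq_add_sub]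
  · rw [homogeneousNetwork_oe h hm hn, homogeneousNetwork_oe h (mt hma.1 hm) (hnb.2 hn)]
    simp only [map_add, map_smul, translation_e, Prod.mk_add_mk, add_right_comm, sub_add_eq_add_sub]
  · rw [homogeneousNetwork_oo h hm hn, homogeneousNetwork_oo h (mt hma.1 hm) (mt hnb.1 hn)]
    simp only [map_add, map_smul, translation_e, Prod.mk_add_mk, sub_add_eq_add_sub]

end Network

end ChalkerCoddington

end

open ChalkerCoddington in
theorem mainTheorem8_general {A : Type*} [CommRing A] [DecidableEq A] [HasParity A] {r t : ℝ}
    (h : r ^ 2 + t ^ 2 = 1) (hrt : r * t ≠ 0) :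
    HasPurelyACSpectrum (network (A := A) r t h fun _ _ => 1) := by
  refine hasPurelyACSpectrum_of_zpow_sub_zpow_neg_eq (a := (r * t)⁻¹) (k := 2)
    (T := translation (2, 0)) (V := translation (0, 2))
    (commute_homogeneousNetwork_translation h even_two Even.zero)
    (commute_homogeneousNetwork_translation h Even.zero even_two)
    (commute_translation _ _) (fun ψ => ?_) span_range_e_topologicalClosure ?_
  · rw [zpow_neg, zpow_two, Complex.ofReal_inv]
    exact (congrArg _ (homogeneousNetwork_sq_sub_symm_sq h ψ)).trans
      (inv_smul_smul₀ (Complex.ofReal_ne_zero.2 hrt) _)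
  · rintro _ ⟨ν, rfl⟩ i j hi
    refine inner_e_translation_zpow_e fun hij => hi ?_
    simpa using congrArg Prod.fst hij

theorem mainTheorem8 (r t : ℝ) (hr : r ∈ Set.Icc (0 : ℝ) 1) (ht : t ∈ Set.Icc (0 : ℝ) 1)
    (h : r ^ 2 + t ^ 2 = 1) (hrt : r * t ≠ 0) :
    HasPurelyACSpectrum (ChalkerCoddington.fullOperator r t h (fun _ _ => 1)) ∧
      ∀ M : ℕ, 1 ≤ M →
        HasPurelyACSpectrum (ChalkerCoddington.cylinderOperator M r t h (fun _ _ => 1)) :=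
  ⟨mainTheorem8_general h hrt, fun _ _ => mainTheorem8_general h hrt⟩
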